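/- All graphs are finite. An edge of a graph $G$ is called lonely if it belongs to exactly one perfect matching of $G$, and $l(G)$ denotes the number of lonely edges of $G$. Let $\mathcal{U}$ be the class of $3$-connected cubic graphs that have at least one lonely edge (such graphs are automatically simple). For a cubic graph $G$ and a vertex $v$ of $G$ with neighbours $x_1,x_2,x_3$, let $G^v$ be the cubic graph obtained from $G$ by replacing $v$ with a triangle, i.e. $V(G^v)=(V(G)\setminus\{v\})\cup\{v_1,v_2,v_3\}$, where $v_1,v_2,v_3$ are new vertices, and $E(G^v)=(E(G)\setminus\{vx_1,vx_2,vx_3\})\cup\{v_1x_1,v_2x_2,v_3x_3\}\cup\{v_1v_2,v_2v_3,v_3v_1\}$. A $v$-join of $G$ is a spanning subgraph of $G$ in which $v$ has degree $3$ and every other vertex has degree $1$. Corollary. For every $G\in\mathcal{U}$ and every $v\in V(G)$, $$l(G^v)=l(G)-p_v,$$ where $p_v$ is the number of lonely edges of $G$ that are not incident with $v$ and are contained in some $v$-join of $G$. -/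

import Mathlib

namespace LonelyEdges

variable {V : Type*}

/-- An edge is lonely if it belongs to exactly one perfect matching. -/
def IsLonely (G : SimpleGraph V) (e : Sym2 V) : Prop :=
  e ∈ G.edgeSet ∧ ∃! M : G.Subgraph, M.IsPerfectMatching ∧ e ∈ M.edgeSet

/-- `l(G)`, the number of lonely edges of `G`. -/
noncomputable def lonelyCount (G : SimpleGraph V) : ℕ :=
  {e : Sym2 V | IsLonely G e}.ncard

/-- (Vertex) 3-connectedness: more than three vertices, and the deletion of fewer than three
vertices never disconnects the graph. -/
def IsThreeConnected [Fintype V] (G : SimpleGraph V) : Prop :=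
  3 < Fintype.card V ∧
    ∀ S : Finset V, S.card < 3 → (G.induce ((S : Set V)ᶜ)).Connected

/-- The class `𝒰` of 3-connected cubic graphs having at least one lonely edge. No generality is
lost by using simple graphs: a cubic multigraph with a loop or a parallel edge is not
3-connected. -/
structure ClassU [Fintype V] (G : SimpleGraph V) [DecidableRel G.Adj] : Prop where
  cubic : G.IsRegularOfDegree 3
  threeConnected : IsThreeConnected G
  exists_lonely : ∃ e, IsLonely G e

/-- The graph `G^v`, in which `v` is replaced with a triangle. Its vertices are the vertices of `G`
other than `v`, together with one new vertex `v_x` for each neighbour `x` of `v` in `G`. -/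
abbrev ExpandVertex (G : SimpleGraph V) (v : V) : Type _ :=
  {w : V // w ≠ v} ⊕ G.neighborSet v

/-- Adjacency in `G^v`: the edges of `G` not incident with `v` are kept, every edge `vx` becomes
`v_x x`, and any two distinct new vertices are joined (a triangle, as `v` has degree three). -/
def expandAdj (G : SimpleGraph V) (v : V) : ExpandVertex G v → ExpandVertex G v → Prop
  | .inl a, .inl b => G.Adj a b
  | .inl a, .inr x => (a : V) = x
  | .inr x, .inl a => (a : V) = x
  | .inr x, .inr y => x ≠ y

/-- The graph `G^v`. -/
def expand (G : SimpleGraph V) (v : V) : SimpleGraph (ExpandVertex G v) where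
  Adj := expandAdj G v
  symm := ⟨by
    rintro (a | x) (b | y) h
    · exact G.adj_symm h
    · exact h
    · exact h
    · exact Ne.symm h⟩
  loopless := ⟨by
    rintro (a | x) h
    · exact G.irrefl h
    · exact h rfl⟩

/-- A `v`-join of `G`: a spanning subgraph in which `v` has degree 3 and every other vertex has
degree 1. -/
def IsJoin (G : SimpleGraph V) (v : V) (J : G.Subgraph) : Prop :=
  J.IsSpanning ∧ (J.neighborSet v).ncard = 3 ∧ ∀ w, w ≠ v → (J.neighborSet w).ncard = 1

/-- `p_v`, the number of lonely edges of `G` not incident with `v` which are contained in some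
`v`-join of `G`. -/
noncomputable def joinLonelyCount (G : SimpleGraph V) (v : V) : ℕ :=
  {e : Sym2 V | IsLonely G e ∧ v ∉ e ∧ ∃ J : G.Subgraph, IsJoin G v J ∧ e ∈ J.edgeSet}.ncard

end LonelyEdges

namespace LonelyEdges

set_option linter.unusedSectionVars false

/-! A perfect matching of `G^v` uses an odd number of the three spokes `v_x x`. If it uses one, it
is the unique lift of a perfect matching of `G` containing `vx`: the spoke at `x` together with the
opposite triangle edge. If it uses all three, it comes from a `v`-join of `G`. Hence a triangle edge
is lonely in `G^v` exactly when the opposite `vx` is lonely in `G` (`isLonely_expand_triangle_iff`).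
Since every edge of `G` lies in a perfect matching, an old edge is lonely in `G^v` exactly when it
is lonely in `G` and in no `v`-join (`isLonely_expand_old_iff`). The formula follows once no spoke
is lonely (`not_isLonely_expand_spoke`).

If `G` has a `v`-join, each spoke lies in a matching of each kind. Otherwise `vx` must be shown to
lie in two perfect matchings of `G` (`exists_two_isMatchFn`). Tutte's theorem on `G - v - N(v)` and
edge counting give a tight barrier `T ⊇ N(v)`: its vertices are adjacent only to `v` and to odd
pieces whose cuts have size 3 (`exists_tight_barrier`). A perfect matching through `vx` matches `T \
{x}` bijectively to the pieces. Each vertex of `T \ {x}` has another edge into a piece; following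
these edges produces an alternating cycle, and switching along it gives a second bijection. It
extends to a perfect matching because a piece minus any end of a cut edge is perfectly matchable
(`exists_isMatchFn_erase`). -/

/-- `f` sends every vertex of `W` to its partner in a perfect matching of `G[W]`. -/
def IsMatchFn {V : Type*} (G : SimpleGraph V) (W : Finset V) (f : V → V) : Prop :=
  ∀ w ∈ W, f w ∈ W ∧ G.Adj w (f w) ∧ f (f w) = w

/-! ### Tutte's theorem on induced subgraphs, in terms of finite vertex sets -/

section Tutte
variable {V : Type*} [Fintype V] [DecidableEq V] (G : SimpleGraph V)

theorem exists_isMatchFn_of_isPerfectMatching {W : Finset V}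
    {M : (G.induce (W : Set V)).Subgraph} (hM : M.IsPerfectMatching) :
    ∃ f, IsMatchFn G W f := by
  rw [SimpleGraph.Subgraph.isPerfectMatching_iff] at hM
  choose p hp hp' using hM
  refine ⟨fun w => if h : w ∈ W then (p ⟨w, h⟩ : V) else w, fun w hw => ?_⟩
  have h1 : ((p ⟨w, hw⟩ : (W : Set V)) : V) ∈ W := (p ⟨w, hw⟩).2
  simp only [hw, dite_true]
  refine ⟨h1, (hp ⟨w, hw⟩).adj_sub, ?_⟩
  simp only [h1, dite_true]
  exact congrArg Subtype.val (hp' _ _ (hp ⟨w, hw⟩).symm).symm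

/-- Tutte's theorem for an induced subgraph on an even number of vertices. -/
theorem exists_barrier {W : Finset V} (hW : Even W.card) (h : ¬ ∃ f, IsMatchFn G W f) :
    ∃ u ⊆ W, ∃ 𝒞 : Finset (Finset V),
      (∀ C ∈ 𝒞, Odd C.card ∧ C ⊆ W \ u ∧ ∀ a ∈ C, ∀ b ∈ W \ u, G.Adj a b → b ∈ C) ∧
      (𝒞 : Set (Finset V)).PairwiseDisjoint id ∧ u.card + 2 ≤ 𝒞.card := by
  classical
  have h1 : ¬ ∃ M : (G.induce (W : Set V)).Subgraph, M.IsPerfectMatching := fun ⟨M, hM⟩ =>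
    h (exists_isMatchFn_of_isPerfectMatching G hM)
  rw [SimpleGraph.tutte] at h1
  push Not at h1
  obtain ⟨u, hu⟩ := h1
  unfold SimpleGraph.IsTutteViolator at hu
  set H := ((⊤ : (G.induce (W : Set V)).Subgraph).deleteVerts u) with hH
  let g : H.verts → V := fun x => x.1.1
  have hg : Function.Injective g := fun x y hxy => Subtype.ext (Subtype.ext hxy)
  have hmem : ∀ x : H.verts, x.1 ∉ u := fun x => x.2.2
  have hcov : ∀ w : (W : Set V), w ∉ u → w ∈ H.verts := fun w hw => ⟨trivial, hw⟩
  let F : H.coe.ConnectedComponent → Finset V := fun c => c.supp.toFinset.image g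
  have hF : ∀ c x, g x ∈ F c ↔ H.coe.connectedComponentMk x = c := by
    intro c x
    simp only [F, Finset.mem_image, Set.mem_toFinset]
    constructor
    · rintro ⟨y, hy, e⟩
      rw [← hg e]; exact hy
    · intro h
      exact ⟨x, h, rfl⟩
  have hFc : ∀ c, (F c).card = c.supp.ncard := by
    intro c
    rw [Finset.card_image_of_injective _ hg, Set.ncard_eq_toFinset_card']
  have hFdis : ∀ c d, ∀ z, z ∈ F c → z ∈ F d → c = d := by
    intro c d z hc hd
    obtain ⟨x, -, rfl⟩ := Finset.mem_image.1 hc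
    rw [← (hF c x).1 hc, ← (hF d x).1 hd]
  have hFinj : Function.Injective F := by
    intro c d hcd
    obtain ⟨x, hx⟩ := c.nonempty_supp
    have : g x ∈ F c := (hF c x).2 hx
    exact hFdis c d _ this (hcd ▸ this)
  have hucard : (u.toFinset.image Subtype.val).card = u.ncard := by
    rw [Finset.card_image_of_injective _ Subtype.val_injective, Set.ncard_eq_toFinset_card']
  have hoc : (H.coe.oddComponents.toFinset.image F).card = H.coe.oddComponents.ncard := by
    rw [Finset.card_image_of_injective _ hFinj, Set.ncard_eq_toFinset_card']
  have hnc : Nat.card H.verts + u.ncard = W.card := by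
    have e1 : H.verts = uᶜ := by
      ext w; exact ⟨fun h => h.2, fun h => hcov w h⟩
    rw [e1, Nat.card_coe_set_eq, add_comm, Set.ncard_add_ncard_compl, Nat.card_eq_fintype_card]
    simp
  have hpar := H.coe.odd_ncard_oddComponents
  refine ⟨u.toFinset.image Subtype.val, ?_, H.coe.oddComponents.toFinset.image F, ?_, ?_, ?_⟩
  · intro w hw
    obtain ⟨x, -, rfl⟩ := Finset.mem_image.1 hw
    exact x.2
  · intro C hC
    obtain ⟨c, hc, rfl⟩ := Finset.mem_image.1 hC
    rw [Set.mem_toFinset] at hc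
    refine ⟨by rw [hFc]; exact hc, ?_, ?_⟩
    · intro z hz
      obtain ⟨x, -, rfl⟩ := Finset.mem_image.1 hz
      refine Finset.mem_sdiff.2 ⟨x.1.2, fun hh => ?_⟩
      obtain ⟨y, hy, e⟩ := Finset.mem_image.1 hh
      rw [Subtype.ext e] at hy
      exact hmem x (Set.mem_toFinset.1 hy)
    · intro a ha b hb hab
      obtain ⟨x, -, rfl⟩ := Finset.mem_image.1 ha
      obtain ⟨hbW, hbu⟩ := Finset.mem_sdiff.1 hb
      have hb' : (⟨b, hbW⟩ : (W : Set V)) ∉ u := fun hh =>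
        hbu (Finset.mem_image.2 ⟨⟨b, hbW⟩, Set.mem_toFinset.2 hh, rfl⟩)
      let y : H.verts := ⟨⟨b, hbW⟩, hcov _ hb'⟩
      have hxy : H.coe.Adj x y := by
        exact SimpleGraph.Subgraph.deleteVerts_adj.2 ⟨trivial, hmem x, trivial, hb', hab⟩
      refine (hF c y).2 ?_
      rw [← (hF c x).1 ha]
      exact (SimpleGraph.ConnectedComponent.sound hxy.reachable).symm
  · intro C hC D hD hCD
    simp only [Finset.coe_image, Set.mem_image] at hC hD
    obtain ⟨c, -, rfl⟩ := hC
    obtain ⟨d, -, rfl⟩ := hD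
    refine Finset.disjoint_left.2 fun z hz hz' => hCD ?_
    rw [hFdis c d z hz hz']
  · rw [hucard, hoc]
    -- The number of odd components has the parity of `|W| - |u|`, hence of `|u|`, so an excess of
    -- exactly one is impossible.
    rcases Nat.lt_or_ge (u.ncard + 1) H.coe.oddComponents.ncard with h' | h'
    · exact h'
    · exfalso
      have : H.coe.oddComponents.ncard = u.ncard + 1 := le_antisymm h' hu
      rw [this] at hpar
      grind

end Tutte

/-! ### Edge counts across cuts of cubic graphs, and matchings obtained from them -/

section Cut
variable {V : Type*} [Fintype V] [DecidableEq V] (G : SimpleGraph V) [DecidableRel G.Adj]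

/-- The number of pairs `(x, y)` of adjacent vertices with `x ∈ X` and `y ∈ Y`. -/
def edgesBetween (X Y : Finset V) : ℕ := ∑ x ∈ X, ∑ y ∈ Y, if G.Adj x y then 1 else 0

theorem edgesBetween_comm (X Y : Finset V) : edgesBetween G X Y = edgesBetween G Y X := by
  unfold edgesBetween
  rw [Finset.sum_comm]
  simp only [G.adj_comm]

theorem edgesBetween_union_right {X Y Z : Finset V} (h : Disjoint Y Z) :
    edgesBetween G X (Y ∪ Z) = edgesBetween G X Y + edgesBetween G X Z := by
  unfold edgesBetween
  rw [← Finset.sum_add_distrib]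
  exact Finset.sum_congr rfl fun x _ => Finset.sum_union h

theorem edgesBetween_union_left {X Y Z : Finset V} (h : Disjoint Y Z) :
    edgesBetween G (Y ∪ Z) X = edgesBetween G Y X + edgesBetween G Z X :=
  Finset.sum_union h

theorem edgesBetween_mono {X X' Y Y' : Finset V} (h : X ⊆ X') (h' : Y ⊆ Y') :
    edgesBetween G X Y ≤ edgesBetween G X' Y' :=
  (Finset.sum_le_sum_of_subset h).trans
    (Finset.sum_le_sum fun _ _ => Finset.sum_le_sum_of_subset h')

theorem edgesBetween_mono_of_adj {X Y Y' : Finset V}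
    (h : ∀ x ∈ X, ∀ y ∈ Y, G.Adj x y → y ∈ Y') :
    edgesBetween G X Y ≤ edgesBetween G X Y' := by
  unfold edgesBetween
  refine Finset.sum_le_sum fun x hx => ?_
  rw [← Finset.sum_filter, ← Finset.sum_filter]
  refine Finset.sum_le_sum_of_subset fun y hy => ?_
  rw [Finset.mem_filter] at hy ⊢
  exact ⟨h x hx y hy.1 hy.2, hy.2⟩

theorem edgesBetween_singleton (x y : V) :
    edgesBetween G {x} {y} = if G.Adj x y then 1 else 0 := by
  rw [edgesBetween, Finset.sum_singleton, Finset.sum_singleton]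

theorem edgesBetween_pos {X Y : Finset V} {x y : V} (hx : x ∈ X) (hy : y ∈ Y) (h : G.Adj x y) :
    1 ≤ edgesBetween G X Y := by
  have := edgesBetween_mono G (Finset.singleton_subset_iff.2 hx) (Finset.singleton_subset_iff.2 hy)
  rwa [edgesBetween_singleton, if_pos h] at this

theorem edgesBetween_sup {ι : Type*} (s : Finset ι) (F : ι → Finset V) (Y : Finset V)
    (h : (s : Set ι).PairwiseDisjoint F) :
    edgesBetween G (s.biUnion F) Y = ∑ i ∈ s, edgesBetween G (F i) Y :=
  Finset.sum_biUnion h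

theorem exists_adj_of_edgesBetween_ne_zero {X Y : Finset V} (h : edgesBetween G X Y ≠ 0) :
    ∃ x ∈ X, ∃ y ∈ Y, G.Adj x y := by
  by_contra! hc
  exact h (Finset.sum_eq_zero fun x hx => Finset.sum_eq_zero fun y hy => if_neg (hc x hx y hy))

theorem even_edgesBetween_self (X : Finset V) : Even (edgesBetween G X X) := by
  induction X using Finset.induction_on with
  | empty => simp [edgesBetween]
  | insert a X ha ih =>
    rw [Finset.insert_eq]
    have hd : Disjoint {a} X := Finset.disjoint_singleton_left.2 ha
    rw [edgesBetween_union_left G hd, edgesBetween_union_right G hd, edgesBetween_union_right G hd,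
      edgesBetween_comm G X {a}]
    have : edgesBetween G {a} {a} = 0 := by simp [edgesBetween]
    grind

variable {G}

theorem edgesBetween_univ (h : G.IsRegularOfDegree 3) (X : Finset V) :
    edgesBetween G X Finset.univ = 3 * X.card := by
  unfold edgesBetween
  have : ∀ x ∈ X, (∑ y, if G.Adj x y then 1 else 0) = 3 := by
    intro x _
    rw [← Finset.card_filter, ← h x, ← G.card_neighborFinset_eq_degree]
    congr 1
    ext y; simp
  rw [Finset.sum_congr rfl this]
  simp [mul_comm]

theorem edgesBetween_self_add_compl (h : G.IsRegularOfDegree 3) (X : Finset V) :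
    edgesBetween G X X + edgesBetween G X Xᶜ = 3 * X.card := by
  rw [← edgesBetween_union_right G disjoint_compl_right, Finset.union_compl, edgesBetween_univ h]

theorem even_card_of_cubic (h : G.IsRegularOfDegree 3) : Even (Finset.univ : Finset V).card := by
  have h1 := edgesBetween_univ h Finset.univ
  have h2 := even_edgesBetween_self G Finset.univ
  grind

/-- Odd vertex sets have at least three leaving edges. -/
def OddCutsLarge (G : SimpleGraph V) [DecidableRel G.Adj] : Prop :=
  ∀ A : Finset V, Odd A.card → 3 ≤ edgesBetween G A Aᶜ

/-- An odd cut of a cubic graph has odd size, so a cut smaller than 3 is a single edge; its end in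
`A` would then be a cut vertex. -/
theorem oddCutsLarge (h : G.IsRegularOfDegree 3) (hc : IsThreeConnected G) : OddCutsLarge G := by
  intro A hA
  have h1 := edgesBetween_self_add_compl h A
  have h2 := even_edgesBetween_self G A
  by_contra hlt
  have h3 : edgesBetween G A Aᶜ = 1 := by grind
  obtain ⟨a, ha, b, hb, hab⟩ := exists_adj_of_edgesBetween_ne_zero G (by rw [h3]; simp)
  have hsplit : ({a} : Finset V) ∪ A.erase a = A := by
    rw [← Finset.insert_eq, Finset.insert_erase ha]
  have hd : Disjoint {a} (A.erase a) := by simp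
  have h4 : edgesBetween G (A.erase a) Aᶜ = 0 := by
    have := edgesBetween_union_left G (X := Aᶜ) hd
    rw [hsplit, h3] at this
    have := edgesBetween_pos G (Finset.mem_singleton_self a) hb hab
    omega
  -- If `A = {a}`, the cut would consist of all three edges at `a`.
  have h5 : ∃ c, c ∈ A.erase a := by
    by_contra! hn
    have : A = {a} := by
      rw [← hsplit, Finset.eq_empty_of_forall_notMem hn]; simp
    rw [this] at h1 h3
    rw [h3] at h1
    rw [edgesBetween_singleton, if_neg (G.irrefl)] at h1
    simp at h1
  obtain ⟨c, hcA⟩ := h5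
  have hconn := hc.2 {a} (by simp)
  have key : ∀ x y : ((({a} : Finset V) : Set V)ᶜ : Set V),
      (G.induce ((({a} : Finset V) : Set V)ᶜ)).Reachable x y → x.1 ∈ A → y.1 ∈ A := by
    intro x y hxy
    obtain ⟨w⟩ := hxy
    induction w with
    | nil => exact id
    | @cons x z y hxz _ ih =>
      intro hx
      refine ih ?_
      by_contra hz
      have := edgesBetween_pos G (X := A.erase a) (Y := Aᶜ) (x := x.1) (y := z.1)
        (Finset.mem_erase.2 ⟨by simpa using x.2, hx⟩) (by simpa using hz) hxz
      omega
  have hba : b ≠ a := hab.ne'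
  have := key ⟨c, by simpa using (Finset.mem_erase.1 hcA).1⟩ ⟨b, by simpa using hba⟩
    (hconn.preconnected _ _) (Finset.mem_erase.1 hcA).2
  exact (Finset.mem_compl.1 hb) this

/-- Deleting from a vertex set with at most three leaving edges an end of one of these edges
leaves a perfectly matchable set. -/
theorem exists_isMatchFn_erase (h : G.IsRegularOfDegree 3) (hG : OddCutsLarge G) {A : Finset V}
    (hA : Odd A.card) (hcut : edgesBetween G A Aᶜ ≤ 3) {a b : V} (ha : a ∈ A) (hb : b ∉ A)
    (hab : G.Adj a b) : ∃ f, IsMatchFn G (A.erase a) f := by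
  by_contra hno
  have hev : Even (A.erase a).card := by
    rw [Finset.card_erase_of_mem ha]; exact Nat.Odd.sub_odd hA odd_one
  obtain ⟨u, hu, 𝒞, h𝒞, hdis, hcard⟩ := exists_barrier G hev hno
  set S := insert a u with hS
  set U := 𝒞.biUnion id with hU
  have hau : a ∉ u := fun hh => by simpa using hu hh
  have hScard : S.card = u.card + 1 := Finset.card_insert_of_notMem hau
  have hUA : ∀ z ∈ U, z ∈ A ∧ z ≠ a ∧ z ∉ u := by
    intro z hz
    obtain ⟨C, hC, hz⟩ := Finset.mem_biUnion.1 hz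
    have := (h𝒞 C hC).2.1 hz
    grind
  have hSA : S ⊆ A := by
    intro z hz
    rcases Finset.mem_insert.1 hz with rfl | hz
    · exact ha
    · exact Finset.mem_of_mem_erase (hu hz)
  have h1 : 3 * 𝒞.card ≤ edgesBetween G U (S ∪ Aᶜ) := by
    rw [hU, edgesBetween_sup G _ _ _ hdis, mul_comm, ← smul_eq_mul]
    refine Finset.card_nsmul_le_sum _ _ _ fun C hC => ?_
    refine (hG C (h𝒞 C hC).1).trans (edgesBetween_mono_of_adj G fun x hx y hy hxy => ?_)
    by_contra hyn
    refine (Finset.mem_compl.1 hy) ((h𝒞 C hC).2.2 x hx y ?_ hxy)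
    simp only [hS, Finset.mem_union, Finset.mem_insert, Finset.mem_compl] at hyn
    grind
  have hdSA : Disjoint S Aᶜ := Finset.disjoint_left.2 fun z hz hz' =>
    Finset.mem_compl.1 hz' (hSA hz)
  have hdSU : Disjoint S U := Finset.disjoint_left.2 fun z hz hz' => by
    have := hUA z hz'
    grind
  rw [edgesBetween_union_right G hdSA, edgesBetween_comm G U S] at h1
  have h2 : edgesBetween G S U + edgesBetween G S Aᶜ ≤ 3 * S.card := by
    rw [← edgesBetween_univ h, ← edgesBetween_union_right G (Finset.disjoint_left.2 fun z hz hz' =>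
      Finset.mem_compl.1 hz' (hUA z hz).1)]
    exact edgesBetween_mono G subset_rfl (Finset.subset_univ _)
  have h3 : edgesBetween G S Aᶜ + edgesBetween G U Aᶜ ≤ 3 := by
    rw [← edgesBetween_union_left G hdSU]
    refine (edgesBetween_mono G (Finset.union_subset hSA fun z hz => (hUA z hz).1) subset_rfl).trans
      hcut
  have h4 : 1 ≤ edgesBetween G S Aᶜ :=
    edgesBetween_pos G (Finset.mem_insert_self a u) (Finset.mem_compl.2 hb) hab
  -- With `s = e(S, Aᶜ) ≥ 1`: `3|𝒞| ≤ e(S, U) + e(U, Aᶜ) ≤ (3|S| - s) + (3 - s) < 3(|S| + 1)`,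
  -- against `|𝒞| ≥ |S| + 1`.
  omega

/-- Every edge of a cubic graph with large odd cuts lies in a perfect matching. -/
theorem exists_isMatchFn_univ (h : G.IsRegularOfDegree 3) (hG : OddCutsLarge G) {a b : V}
    (hab : G.Adj a b) : ∃ f, IsMatchFn G Finset.univ f ∧ f a = b := by
  have hcard := even_card_of_cubic h
  have hpos : 0 < (Finset.univ : Finset V).card := Finset.card_pos.2 ⟨a, Finset.mem_univ a⟩
  have hA : Odd ((Finset.univ : Finset V).erase b).card := by
    rw [Finset.card_erase_of_mem (Finset.mem_univ b)]
    exact Nat.Even.sub_odd hpos hcard odd_one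
  have hcompl : ((Finset.univ : Finset V).erase b)ᶜ = {b} := by ext; simp
  have hcut : edgesBetween G (Finset.univ.erase b) (Finset.univ.erase b)ᶜ ≤ 3 := by
    rw [hcompl, edgesBetween_comm]
    refine (edgesBetween_mono G subset_rfl (Finset.subset_univ _)).trans ?_
    rw [edgesBetween_univ h]; simp
  obtain ⟨f, hf⟩ := exists_isMatchFn_erase h hG hA hcut (a := a) (b := b)
    (by simp [hab.ne]) (by simp) hab
  refine ⟨fun w => if w = a then b else if w = b then a else f w, fun w _ => ?_, by simp⟩
  have hne := hab.ne
  have hba := hab.symm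
  by_cases hwa : w = a
  · subst hwa; simp [hab, hne.symm]
  by_cases hwb : w = b
  · subst hwb; simp [hba, hne.symm]
  have := hf w (by simp [hwa, hwb])
  simp only [Finset.mem_erase, Finset.mem_univ, and_true] at this
  simp [hwa, hwb, this.1.1, this.1.2, this.2.1, this.2.2]

end Cut

/-! ### Tight barriers and switching along an alternating cycle -/

section Switch
variable {V : Type*} [Fintype V] [DecidableEq V] {G : SimpleGraph V} [DecidableRel G.Adj]

theorem forall_of_adj_closed {V : Type*} {G : SimpleGraph V} (hconn : G.Connected) {P : V → Prop}
    {v : V} (hv : P v) (hP : ∀ a b, G.Adj a b → P a → P b) (w : V) : P w := by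
  obtain ⟨p⟩ := hconn.preconnected v w
  induction p with
  | nil => exact hv
  | cons hab _ ih => exact ih (hP _ _ hab hv)

/-- If no `v`-join exists, then a tight barrier of `G` isolates `v`. -/
theorem exists_tight_barrier (h : G.IsRegularOfDegree 3) (hG : OddCutsLarge G)
    (hconn : G.Connected) {v : V}
    (hno : ¬ ∃ g, IsMatchFn G (insert v (G.neighborFinset v))ᶜ g) :
    ∃ (T : Finset V) (𝒞 : Finset (Finset V)), G.neighborFinset v ⊆ T ∧ v ∉ T ∧
      𝒞.card + 1 = T.card ∧ (𝒞 : Set (Finset V)).PairwiseDisjoint id ∧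
      (∀ C ∈ 𝒞, Odd C.card ∧ edgesBetween G C Cᶜ = 3 ∧ v ∉ C ∧ (∀ t ∈ T, t ∉ C) ∧
        ∀ a ∈ C, ∀ b, G.Adj a b → b ∈ C ∨ b ∈ T) ∧
      (∀ t ∈ T, ∀ y, G.Adj t y → y = v ∨ ∃ C ∈ 𝒞, y ∈ C) ∧
      ∀ w, w = v ∨ w ∈ T ∨ ∃ C ∈ 𝒞, w ∈ C := by
  set N := G.neighborFinset v with hN
  have hNcard : N.card = 3 := by rw [hN, G.card_neighborFinset_eq_degree, h v]
  have hvN : v ∉ N := by simp [hN]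
  have hWcard : (insert v N)ᶜ.card + 4 = Fintype.card V := by
    have := Finset.card_compl_add_card (insert v N)
    rw [Finset.card_insert_of_notMem hvN, hNcard] at this
    exact this
  have hW : Even (insert v N)ᶜ.card := by
    have := even_card_of_cubic h
    rw [Finset.card_univ, ← hWcard] at this
    grind
  obtain ⟨u, hu, 𝒞, h𝒞, hdis, hcard⟩ := exists_barrier G hW hno
  have huN : ∀ z ∈ u, z ≠ v ∧ z ∉ N := fun z hz => by
    have := hu hz
    simpa [not_or] using this
  have hCN : ∀ C ∈ 𝒞, ∀ z ∈ C, z ≠ v ∧ z ∉ N ∧ z ∉ u := fun C hC z hz => by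
    have := (h𝒞 C hC).2.1 hz
    simpa [not_or, and_assoc] using this
  set T := u ∪ N with hT
  have hTcard : T.card = u.card + 3 := by
    rw [hT, Finset.card_union_of_disjoint (Finset.disjoint_left.2 fun z hz => (huN z hz).2), hNcard]
  have hvT : v ∉ T := by
    rw [hT, Finset.mem_union, not_or]
    exact ⟨fun hh => (huN v hh).1 rfl, hvN⟩
  have hCadj : ∀ C ∈ 𝒞, ∀ a ∈ C, ∀ b, G.Adj a b → b ∈ C ∨ b ∈ T := by
    intro C hC a ha b hab
    by_cases hb : b ∈ (insert v N)ᶜ \ u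
    · exact Or.inl ((h𝒞 C hC).2.2 a ha b hb hab)
    · have hbv : b ≠ v := by
        rintro rfl
        exact (hCN C hC a ha).2.1 (by rw [hN, G.mem_neighborFinset]; exact hab.symm)
      right
      rw [hT, Finset.mem_union]
      simp only [Finset.mem_sdiff, Finset.mem_compl, Finset.mem_insert] at hb
      tauto
  set U := 𝒞.biUnion id with hU
  have hsum : edgesBetween G U T = ∑ C ∈ 𝒞, edgesBetween G C T := edgesBetween_sup G _ _ _ hdis
  have hcutT : ∀ C ∈ 𝒞, edgesBetween G C Cᶜ ≤ edgesBetween G C T := fun C hC =>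
    edgesBetween_mono_of_adj G fun a ha b hb hab =>
      (hCadj C hC a ha b hab).resolve_left (Finset.mem_compl.1 hb)
  have hge : ∀ C ∈ 𝒞, 3 ≤ edgesBetween G C T := fun C hC =>
    (hG C (h𝒞 C hC).1).trans (hcutT C hC)
  have hvU : v ∉ U := fun hh => by
    obtain ⟨C, hC, hz⟩ := Finset.mem_biUnion.1 hh
    exact (hCN C hC v hz).1 rfl
  have h1 : 3 * 𝒞.card ≤ edgesBetween G U T := by
    rw [hsum, mul_comm, ← smul_eq_mul]
    exact Finset.card_nsmul_le_sum _ _ _ hge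
  have h2 : 3 ≤ edgesBetween G T {v} := by
    rw [edgesBetween_comm]
    have : edgesBetween G {v} Finset.univ = 3 := by rw [edgesBetween_univ h]; simp
    rw [← this]
    refine edgesBetween_mono_of_adj G fun a ha b _ hab => ?_
    rw [Finset.mem_singleton] at ha
    subst ha
    rw [hT, Finset.mem_union, hN, G.mem_neighborFinset]
    exact Or.inr hab
  have hd : Disjoint {v} U := Finset.disjoint_singleton_left.2 hvU
  have h3 : edgesBetween G T {v} + edgesBetween G T U + edgesBetween G T ({v} ∪ U)ᶜ = 3 * T.card := by
    rw [← edgesBetween_union_right G hd, ← edgesBetween_union_right G disjoint_compl_right,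
      Finset.union_compl, edgesBetween_univ h]
  rw [edgesBetween_comm G U T] at h1 hsum
  -- `3|𝒞| ≤ e(T, U) ≤ 3|T| - 3 = 3|u| + 6 ≤ 3|𝒞|`, so equality holds throughout; the tightness
  -- properties below are read off from this.
  have hk : 𝒞.card = u.card + 2 := by omega
  have h4 : edgesBetween G T ({v} ∪ U)ᶜ = 0 := by omega
  have hTadj : ∀ t ∈ T, ∀ y, G.Adj t y → y = v ∨ ∃ C ∈ 𝒞, y ∈ C := by
    intro t ht y hty
    by_contra hc
    have := edgesBetween_pos G (X := T) (Y := ({v} ∪ U)ᶜ) ht (y := y) (by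
      simp only [hU, Finset.mem_compl, Finset.mem_union, Finset.mem_singleton, Finset.mem_biUnion,
        id]
      exact hc) hty
    omega
  have hcut : ∀ C ∈ 𝒞, edgesBetween G C Cᶜ = 3 := by
    intro C hC
    refine le_antisymm ((hcutT C hC).trans ?_) (hG C (h𝒞 C hC).1)
    by_contra hlt
    have : ∑ C ∈ 𝒞, 3 < ∑ C ∈ 𝒞, edgesBetween G C T :=
      Finset.sum_lt_sum hge ⟨C, hC, not_le.1 hlt⟩
    rw [← hsum, Finset.sum_const, smul_eq_mul] at this
    omega
  refine ⟨T, 𝒞, Finset.subset_union_right, hvT, by omega, hdis, fun C hC => ⟨(h𝒞 C hC).1,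
    hcut C hC, fun hh => (hCN C hC v hh).1 rfl, fun t ht htC => ?_, hCadj C hC⟩, hTadj, fun w => ?_⟩
  · rw [hT, Finset.mem_union] at ht
    have := hCN C hC t htC
    tauto
  · refine forall_of_adj_closed hconn (P := fun w => w = v ∨ w ∈ T ∨ ∃ C ∈ 𝒞, w ∈ C)
      (v := v) (Or.inl rfl) (fun a b hab hP => ?_) w
    rcases hP with rfl | hb | ⟨C, hC, hb⟩
    · right; left
      rw [hT, Finset.mem_union, hN, G.mem_neighborFinset]
      exact Or.inr hab
    · rcases hTadj a hb b hab with h | h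
      · exact Or.inl h
      · exact Or.inr (Or.inr h)
    · rcases hCadj C hC a hb b hab with h | h
      · exact Or.inr (Or.inr ⟨C, hC, h⟩)
      · exact Or.inr (Or.inl h)

theorem exists_mem_apply_notMem_of_odd {f : V → V} (hf : IsMatchFn G Finset.univ f) {C : Finset V}
    (hC : Odd C.card) : ∃ w ∈ C, f w ∉ C := by
  by_contra! hc
  -- If `f` preserved `C`, it would be a fixed-point-free involution on it.
  have h1 : (∑ _x ∈ C, (1 : ZMod 2)) = 0 :=
    Finset.sum_involution (fun w _ => f w) (fun _ _ => by decide)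
      (fun w _ _ => (hf w (Finset.mem_univ w)).2.1.ne') hc
      (fun w _ => (hf w (Finset.mem_univ w)).2.2)
  rw [Finset.sum_const, nsmul_one, ZMod.natCast_eq_zero_iff_even] at h1
  exact Nat.not_even_iff_odd.2 hC h1

theorem periodicPts_nonempty {α : Type*} [Finite α] [Nonempty α] (φ : α → α) :
    (Function.periodicPts φ).Nonempty := by
  obtain ⟨a⟩ := ‹Nonempty α›
  obtain ⟨m, n, hmn, e⟩ := Finite.exists_ne_map_eq_of_infinite (fun n : ℕ => φ^[n] a)
  wlog hlt : m < n generalizing m n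
  · exact this n m hmn.symm e.symm (lt_of_le_of_ne (not_lt.1 hlt) hmn.symm)
  refine ⟨φ^[m] a, n - m, Nat.sub_pos_of_lt hlt, ?_⟩
  show φ^[n - m] (φ^[m] a) = φ^[m] a
  rw [← Function.iterate_add_apply, Nat.sub_add_cancel hlt.le]
  exact e.symm

/-- Perfect matchings of the pieces `{v, x}` and `{t} ∪ κ t` fit together. -/
theorem exists_isMatchFn_of_pieces {v x : V} (hvx : G.Adj v x) {T' : Finset V} (hvT : v ∉ T')
    (hxT : x ∉ T') (κ : T' → Finset V) (e : T' → V) (he : ∀ t, e t ∈ κ t ∧ G.Adj t (e t))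
    (hκ : ∀ t, v ∉ κ t ∧ x ∉ κ t ∧ ∀ s ∈ T', s ∉ κ t) (hdis : ∀ s t w, w ∈ κ s → w ∈ κ t → s = t)
    (hcov : ∀ w, w = v ∨ w = x ∨ w ∈ T' ∨ ∃ t, w ∈ κ t)
    (hm : ∀ t, ∃ g, IsMatchFn G ((κ t).erase (e t)) g) :
    ∃ f, IsMatchFn G Finset.univ f ∧ f v = x ∧ ∀ t : T', f t = e t := by
  choose g hg using hm
  -- The last default value is never reached, since the pieces cover `V`.
  let f : V → V := fun w => if w = v then x else if w = x then v else
    if hw : w ∈ T' then e ⟨w, hw⟩ else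
    if hw : ∃ t, w ∈ κ t then (if w = e hw.choose then (hw.choose : V) else g hw.choose w) else w
  have fv : f v = x := by simp [f]
  have fx : f x = v := by simp [f, hvx.ne']
  have fT : ∀ t : T', f t = e t := by
    intro t
    have h1 : (t : V) ≠ v := fun hh => hvT (hh ▸ t.2)
    have h2 : (t : V) ≠ x := fun hh => hxT (hh ▸ t.2)
    simp [f, h1, h2]
  have fκ : ∀ t, ∀ w ∈ κ t, f w = if w = e t then (t : V) else g t w := by
    intro t w hw
    have h1 : w ≠ v := fun hh => (hκ t).1 (hh ▸ hw)
    have h2 : w ≠ x := fun hh => (hκ t).2.1 (hh ▸ hw)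
    have h3 : w ∉ T' := fun hh => (hκ t).2.2 w hh hw
    have h4 : ∃ t, w ∈ κ t := ⟨t, hw⟩
    have h5 : h4.choose = t := hdis _ _ w h4.choose_spec hw
    simp only [f, h1, h2, h3, h4, if_false, dite_false, dite_true, h5]
  refine ⟨f, fun w _ => ⟨Finset.mem_univ _, ?_⟩, fv, fT⟩
  rcases hcov w with rfl | rfl | hw | ⟨t, hw⟩
  · rw [fv, fx]; exact ⟨hvx, rfl⟩
  · rw [fx, fv]; exact ⟨hvx.symm, rfl⟩
  · have := he ⟨w, hw⟩
    rw [fT ⟨w, hw⟩, fκ _ _ this.1, if_pos rfl]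
    exact ⟨this.2, rfl⟩
  · rw [fκ t w hw]
    split_ifs with hwe
    · rw [fT, hwe]
      exact ⟨(he t).2.symm, rfl⟩
    · obtain ⟨h1, h2, h3⟩ := hg t w (Finset.mem_erase.2 ⟨hwe, hw⟩)
      rw [fκ t _ (Finset.mem_of_mem_erase h1), if_neg (Finset.ne_of_mem_erase h1)]
      exact ⟨h2, h3⟩

/-- If no `v`-join exists, then every edge at `v` is in at least two perfect matchings. -/
theorem exists_two_isMatchFn (h : G.IsRegularOfDegree 3) (hG : OddCutsLarge G)
    (hconn : G.Connected) {v x : V} (hvx : G.Adj v x)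
    (hno : ¬ ∃ g, IsMatchFn G (insert v (G.neighborFinset v))ᶜ g) :
    ∃ f₁ f₂, IsMatchFn G Finset.univ f₁ ∧ IsMatchFn G Finset.univ f₂ ∧ f₁ v = x ∧ f₂ v = x ∧
      f₁ ≠ f₂ := by
  obtain ⟨T, 𝒞, hNT, hvT, hcard, hdis, h𝒞, hTadj, hcov⟩ := exists_tight_barrier h hG hconn hno
  obtain ⟨f₁, hf₁, hf₁v⟩ := exists_isMatchFn_univ h hG hvx
  have hinv : ∀ w, f₁ (f₁ w) = w := fun w => (hf₁ w (Finset.mem_univ w)).2.2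
  have hadj : ∀ w, G.Adj w (f₁ w) := fun w => (hf₁ w (Finset.mem_univ w)).2.1
  have huniq : ∀ C ∈ 𝒞, ∀ D ∈ 𝒞, ∀ w, w ∈ C → w ∈ D → C = D := by
    intro C hC D hD w hwC hwD
    by_contra hne
    exact Finset.disjoint_left.1 (hdis hC hD hne) hwC hwD
  have hxT : x ∈ T := hNT ((G.mem_neighborFinset v x).2 hvx)
  set T' := T.erase x with hT'
  have hT'T : ∀ t : T', (t : V) ∈ T := fun t => Finset.mem_of_mem_erase t.2
  have hT'x : ∀ t : T', (t : V) ≠ x := fun t => Finset.ne_of_mem_erase t.2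
  have hT'card : Fintype.card T' = Fintype.card 𝒞 := by
    rw [Fintype.card_coe, Fintype.card_coe, Finset.card_erase_of_mem hxT]; omega
  have hne : Nonempty T' := by
    have : (G.neighborFinset v).card = 3 := by rw [G.card_neighborFinset_eq_degree, h v]
    obtain ⟨y, hy, hyx⟩ := Finset.exists_mem_ne (by omega : 1 < (G.neighborFinset v).card) x
    exact ⟨⟨y, Finset.mem_erase.2 ⟨hyx, hNT hy⟩⟩⟩
  have hblk : ∀ t : T', ∀ y, G.Adj t y → y ≠ v → ∃ C : 𝒞, y ∈ (C : Finset V) := by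
    intro t y hty hyv
    obtain ⟨C, hC, hy⟩ := (hTadj t (hT'T t) y hty).resolve_left hyv
    exact ⟨⟨C, hC⟩, hy⟩
  have hf₁t : ∀ t : T', f₁ t ≠ v := fun t hh => hT'x t (by rw [← hf₁v, ← hh, hinv])
  choose c hc using fun t : T' => hblk t (f₁ t) (hadj t) (hf₁t t)
  -- An odd piece has a vertex matched outside it, necessarily into `T`, and not to `x`, whose
  -- partner is `v`.
  have hcsurj : Function.Surjective c := by
    rintro ⟨C, hC⟩
    obtain ⟨w, hw, hw'⟩ := exists_mem_apply_notMem_of_odd hf₁ (h𝒞 C hC).1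
    have hT : f₁ w ∈ T := ((h𝒞 C hC).2.2.2.2 w hw _ (hadj w)).resolve_left hw'
    have hx : f₁ w ≠ x := by
      intro hh
      have : w = v := by rw [← hinv w, hh, ← hf₁v, hinv]
      exact (h𝒞 C hC).2.2.1 (this ▸ hw)
    refine ⟨⟨f₁ w, Finset.mem_erase.2 ⟨hx, hT⟩⟩, Subtype.ext ?_⟩
    refine huniq _ (c _).2 C hC w ?_ hw
    have := hc ⟨f₁ w, Finset.mem_erase.2 ⟨hx, hT⟩⟩
    rwa [hinv] at this
  have hcbij : Function.Bijective c :=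
    (Fintype.bijective_iff_surjective_and_card c).2 ⟨hcsurj, hT'card⟩
  -- Degree 3 leaves a neighbour besides the partner of `t` and possibly `v`.
  have hn : ∀ t : T', ∃ y, G.Adj t y ∧ y ≠ f₁ t ∧ y ≠ v := by
    intro t
    have h1 : (G.neighborFinset (t : V)).card = 3 := by rw [G.card_neighborFinset_eq_degree, h]
    have h2 : ({f₁ t, v} : Finset V).card ≤ 2 := Finset.card_le_two
    obtain ⟨y, hy, hy'⟩ := Finset.exists_mem_notMem_of_card_lt_card
      (by omega : ({f₁ t, v} : Finset V).card < (G.neighborFinset (t : V)).card)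
    simp only [Finset.mem_insert, Finset.mem_singleton, not_or] at hy'
    exact ⟨y, (G.mem_neighborFinset _ _).1 hy, hy'⟩
  choose n hnadj hnf hnv using hn
  choose d hd using fun t : T' => hblk t (n t) (hnadj t) (hnv t)
  let τ := (Equiv.ofBijective c hcbij).symm
  -- `φ` follows the alternative edge from `t` into a piece, then the matching back to `T'`. A cycle
  -- of `φ` is an alternating cycle after contracting the pieces; it may have length one, with two
  -- edges from `t` to the same piece.
  let φ : T' → T' := fun t => τ (d t)
  obtain ⟨p, hp⟩ := periodicPts_nonempty φ
  have hbij := Function.bijOn_periodicPts φ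
  classical
  let e : T' → V := fun t => if t ∈ Function.periodicPts φ then n t else f₁ t
  let κ : T' → 𝒞 := fun t => if t ∈ Function.periodicPts φ then d t else c t
  have heκ : ∀ t, e t ∈ (κ t : Finset V) ∧ G.Adj t (e t) := by
    intro t
    simp only [e, κ]
    split_ifs
    · exact ⟨hd t, hnadj t⟩
    · exact ⟨hc t, hadj t⟩
  have hτc : ∀ t, τ (c t) = t := fun t => (Equiv.ofBijective c hcbij).symm_apply_apply t
  -- `τ ∘ κ` is `φ` on the periodic points, which `φ` permutes, and the identity elsewhere.
  have hκinj : Function.Injective κ := by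
    intro s t hst
    have hst' : τ (κ s) = τ (κ t) := congrArg τ hst
    simp only [κ] at hst'
    by_cases hs : s ∈ Function.periodicPts φ <;> by_cases ht : t ∈ Function.periodicPts φ <;>
      simp only [hs, ht, if_true, if_false, hτc] at hst'
    · exact hbij.injOn hs ht hst'
    · exact absurd (hst' ▸ hbij.mapsTo hs) ht
    · exact absurd (hst' ▸ hbij.mapsTo ht) hs
    · exact hst'
  have hκbij : Function.Bijective κ :=
    (Fintype.bijective_iff_injective_and_card κ).2 ⟨hκinj, hT'card⟩
  obtain ⟨f₂, hf₂, hf₂v, hf₂t⟩ := exists_isMatchFn_of_pieces (G := G) hvx (T' := T')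
    (fun hh => hvT (Finset.mem_of_mem_erase hh)) (by simp [hT']) (fun t => (κ t : Finset V)) e heκ
    (fun t => ⟨(h𝒞 _ (κ t).2).2.2.1, (h𝒞 _ (κ t).2).2.2.2.1 x hxT,
      fun s hs => (h𝒞 _ (κ t).2).2.2.2.1 s (Finset.mem_of_mem_erase hs)⟩)
    (fun s t w hs ht => hκinj (Subtype.ext (huniq _ (κ s).2 _ (κ t).2 w hs ht)))
    (fun w => by
      rcases hcov w with hw | hw | ⟨C, hC, hw⟩
      · exact Or.inl hw
      · by_cases hwx : w = x
        · exact Or.inr (Or.inl hwx)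
        · exact Or.inr (Or.inr (Or.inl (Finset.mem_erase.2 ⟨hwx, hw⟩)))
      · obtain ⟨t, ht⟩ := hκbij.2 ⟨C, hC⟩
        refine Or.inr (Or.inr (Or.inr ⟨t, ?_⟩))
        rw [ht]; exact hw)
    (fun t => exists_isMatchFn_erase h hG (h𝒞 _ (κ t).2).1 (h𝒞 _ (κ t).2).2.1.le (heκ t).1
      ((h𝒞 _ (κ t).2).2.2.2.1 t (hT'T t)) (heκ t).2.symm)
  refine ⟨f₁, f₂, hf₁, hf₂, hf₁v, hf₂v, fun hh => hnf p ?_⟩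
  have := hf₂t p
  simp only [e, hp, if_true] at this
  rw [← this, hh]

end Switch

/-! ### Perfect matchings as partner functions -/

section Partner
variable {V : Type*} {G : SimpleGraph V}

/-- `f` sends every vertex to its partner in a perfect matching of `G`. -/
def IsPartnerFn (G : SimpleGraph V) (f : V → V) : Prop := ∀ w, G.Adj w (f w) ∧ f (f w) = w

theorem isMatchFn_univ_iff [Fintype V] {f : V → V} :
    IsMatchFn G Finset.univ f ↔ IsPartnerFn G f := by
  simp [IsMatchFn, IsPartnerFn]

theorem IsPartnerFn.apply_eq_comm {f : V → V} (hf : IsPartnerFn G f) {a b : V} :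
    f a = b ↔ f b = a :=
  ⟨fun h => by rw [← h, (hf a).2], fun h => by rw [← h, (hf b).2]⟩

/-- The perfect matching with a given partner function. -/
def IsPartnerFn.toSubgraph {f : V → V} (hf : IsPartnerFn G f) : G.Subgraph where
  verts := Set.univ
  Adj a b := f a = b
  adj_sub {a _} h := h ▸ (hf a).1
  edge_vert _ := trivial
  symm := ⟨fun _ _ h => hf.apply_eq_comm.1 h⟩

theorem IsPartnerFn.isPerfectMatching {f : V → V} (hf : IsPartnerFn G f) :
    hf.toSubgraph.IsPerfectMatching :=
  SimpleGraph.Subgraph.isPerfectMatching_iff.2 fun v => ⟨f v, rfl, fun _ h => Eq.symm h⟩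

theorem exists_isPartnerFn_of_isPerfectMatching {M : G.Subgraph} (hM : M.IsPerfectMatching) :
    ∃ f, IsPartnerFn G f ∧ ∀ a b, M.Adj a b ↔ f a = b := by
  rw [SimpleGraph.Subgraph.isPerfectMatching_iff] at hM
  choose f hf hf' using hM
  exact ⟨f, fun w => ⟨(hf w).adj_sub, (hf' _ _ (hf w).symm).symm⟩, fun a b =>
    ⟨fun h => (hf' _ _ h).symm, fun h => h ▸ hf a⟩⟩

theorem isLonely_mk_iff {a b : V} : IsLonely G s(a, b) ↔ ∃! f, IsPartnerFn G f ∧ f a = b := by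
  constructor
  · rintro ⟨-, M, ⟨hM, hab⟩, huniq⟩
    obtain ⟨f, hf, hfM⟩ := exists_isPartnerFn_of_isPerfectMatching hM
    refine ⟨f, ⟨hf, (hfM a b).1 hab⟩, fun g ⟨hg, hgab⟩ => ?_⟩
    have := huniq hg.toSubgraph ⟨hg.isPerfectMatching, hgab⟩
    funext w
    have h1 : M.Adj w (g w) := by rw [← this]; rfl
    exact ((hfM _ _).1 h1).symm
  · rintro ⟨f, ⟨hf, hab⟩, huniq⟩
    refine ⟨by rw [SimpleGraph.mem_edgeSet, ← hab]; exact (hf a).1, hf.toSubgraph,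
      ⟨hf.isPerfectMatching, hab⟩, fun M ⟨hM, hMab⟩ => ?_⟩
    obtain ⟨g, hg, hgM⟩ := exists_isPartnerFn_of_isPerfectMatching hM
    have : g = f := huniq g ⟨hg, (hgM a b).1 hMab⟩
    subst this
    ext x y
    · exact ⟨fun _ => trivial, fun _ => hM.2 x⟩
    · exact hgM x y

end Partner

/-! ### `v`-joins as matchings avoiding the closed neighbourhood of `v` -/

section Join
variable {V : Type*} [Fintype V] [DecidableEq V] {G : SimpleGraph V} [DecidableRel G.Adj]

theorem mem_compl_insert_neighborFinset {v : V} (w : V) :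
    w ∈ (insert v (G.neighborFinset v))ᶜ ↔ w ≠ v ∧ ¬ G.Adj v w := by
  simp

/-- A `v`-join contains all three edges at `v`, which saturate the neighbours of `v`; what remains
is a perfect matching of the other vertices. -/
theorem exists_isJoin_iff (h : G.IsRegularOfDegree 3) {v a b : V} (ha : a ≠ v) (hb : b ≠ v) :
    (∃ J : G.Subgraph, IsJoin G v J ∧ s(a, b) ∈ J.edgeSet) ↔
      ∃ g, IsMatchFn G (insert v (G.neighborFinset v))ᶜ g ∧
        a ∈ (insert v (G.neighborFinset v))ᶜ ∧ g a = b := by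
  have hmem := mem_compl_insert_neighborFinset (G := G) (v := v)
  have hdeg : (G.neighborSet v).ncard = 3 := by
    rw [Set.ncard_eq_toFinset_card']; exact h v
  constructor
  · rintro ⟨J, ⟨-, hJv, hJ⟩, hab⟩
    have hJN : J.neighborSet v = G.neighborSet v :=
      Set.eq_of_subset_of_ncard_le (J.neighborSet_subset v) (by rw [hJv, hdeg])
    have hJv' : ∀ w, G.Adj v w → J.Adj w v := fun w hw => by
      have : w ∈ J.neighborSet v := by rw [hJN]; exact hw
      exact J.adj_symm this
    have hex : ∀ w, ∃ y, w ≠ v → ∀ z, J.Adj w z ↔ z = y := by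
      intro w
      by_cases hw : w = v
      · exact ⟨v, fun hh => absurd hw hh⟩
      · obtain ⟨y, hy⟩ := Set.ncard_eq_one.1 (hJ w hw)
        exact ⟨y, fun _ z => Set.ext_iff.1 hy z⟩
    choose g hg using hex
    refine ⟨g, fun w hw => ?_, ?_, ((hg a ha b).1 hab).symm⟩
    · rw [hmem] at hw
      have h1 : J.Adj w (g w) := (hg w hw.1 _).2 rfl
      have h2 : g w ≠ v := fun hh => hw.2 (hh ▸ h1.adj_sub).symm
      refine ⟨(hmem _).2 ⟨h2, fun hh => ?_⟩, h1.adj_sub, ((hg _ h2 w).1 h1.symm).symm⟩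
      exact hw.1 (((hg _ h2 w).1 h1.symm).trans ((hg _ h2 v).1 (hJv' _ hh)).symm)
    · rw [hmem]
      refine ⟨ha, fun hh => hb ?_⟩
      exact ((hg a ha b).1 hab).trans ((hg a ha v).1 (hJv' a hh)).symm
  · rintro ⟨g, hg, haW, hab⟩
    let J : G.Subgraph :=
      { verts := Set.univ
        Adj := fun x y => G.Adj x y ∧
          (x = v ∨ y = v ∨ (x ∈ (insert v (G.neighborFinset v))ᶜ ∧ g x = y))
        adj_sub := fun hh => hh.1
        edge_vert := fun _ => trivial
        symm := ⟨fun x y hh => ⟨hh.1.symm, by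
          rcases hh.2 with h1 | h1 | ⟨h1, h2⟩
          · exact Or.inr (Or.inl h1)
          · exact Or.inl h1
          · obtain ⟨h3, -, h4⟩ := hg x h1
            rw [h2] at h3 h4
            exact Or.inr (Or.inr ⟨h3, h4⟩)⟩⟩ }
    refine ⟨J, ⟨fun _ => trivial, ?_, fun w hw => ?_⟩, ?_⟩
    · have : J.neighborSet v = G.neighborSet v := by
        ext w
        exact ⟨fun hh => hh.1, fun hh => ⟨hh, Or.inl rfl⟩⟩
      rw [this, hdeg]
    · rw [Set.ncard_eq_one]
      by_cases hvw : G.Adj v w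
      · refine ⟨v, Set.ext fun z => ⟨fun hz => ?_, ?_⟩⟩
        · rcases hz.2 with h1 | h1 | ⟨h1, -⟩
          · exact absurd h1 hw
          · exact h1
          · exact absurd hvw ((hmem w).1 h1).2
        · rintro rfl
          exact ⟨hvw.symm, Or.inr (Or.inl rfl)⟩
      · have hwW := (hmem w).2 ⟨hw, hvw⟩
        refine ⟨g w, Set.ext fun z => ⟨fun hz => ?_, ?_⟩⟩
        · rcases hz.2 with h1 | h1 | ⟨-, h1⟩
          · exact absurd h1 hw
          · exact absurd (h1 ▸ hz.1).symm hvw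
          · exact h1.symm
        · rintro rfl
          exact ⟨(hg w hwW).2.1, Or.inr (Or.inr ⟨hwW, rfl⟩)⟩
    · exact ⟨hab ▸ (hg a haW).2.1, Or.inr (Or.inr ⟨haW, hab⟩)⟩

end Join

/-! ### Perfect matchings of `G^v` against perfect matchings and `v`-joins of `G` -/

section Expand
variable {V : Type*} [Fintype V] [DecidableEq V] {G : SimpleGraph V} [DecidableRel G.Adj] {v : V}

/-- The old vertex to which the new vertex `v_x` is attached. -/
def outer (x : G.neighborSet v) : {w : V // w ≠ v} := ⟨x, (G.ne_of_adj x.2).symm⟩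

theorem exists_third (h : G.IsRegularOfDegree 3) {y z : G.neighborSet v} (hyz : y ≠ z) :
    ∃ x, x ≠ y ∧ x ≠ z ∧ ∀ u, u = x ∨ u = y ∨ u = z := by
  have hcard : (Finset.univ : Finset (G.neighborSet v)).card = 3 := by
    rw [Finset.card_univ, G.card_neighborSet_eq_degree, h v]
  have h1 : (Finset.univ \ {y, z} : Finset (G.neighborSet v)).card = 1 := by
    rw [Finset.card_sdiff_of_subset (Finset.subset_univ _), hcard, Finset.card_pair hyz]
  obtain ⟨x, hx⟩ := Finset.card_eq_one.1 h1
  have hx' : ∀ u, ¬ (u = y ∨ u = z) ↔ u = x := fun u => by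
    simpa using Finset.ext_iff.1 hx u
  have h2 := (hx' x).2 rfl
  refine ⟨x, fun hh => h2 (Or.inl hh), fun hh => h2 (Or.inr hh), fun u => ?_⟩
  by_cases hu : u = y ∨ u = z
  · exact Or.inr hu
  · exact Or.inl ((hx' u).1 hu)

theorem exists_other_two (h : G.IsRegularOfDegree 3) (x : G.neighborSet v) :
    ∃ y z, x ≠ y ∧ x ≠ z ∧ y ≠ z ∧ ∀ u, u = x ∨ u = y ∨ u = z := by
  have hcard : 1 < (Finset.univ : Finset (G.neighborSet v)).card := by
    rw [Finset.card_univ, G.card_neighborSet_eq_degree, h v]; norm_num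
  obtain ⟨y, -, hyx⟩ := Finset.exists_mem_ne hcard x
  obtain ⟨z, hzx, hzy, hall⟩ := exists_third h hyx.symm
  refine ⟨y, z, hyx.symm, hzx.symm, hzy.symm, fun u => ?_⟩
  have := hall u
  tauto

section Match
variable {F : ExpandVertex G v → ExpandVertex G v} (hF : IsPartnerFn (expand G v) F)
include hF

theorem apply_inr_cases (y : G.neighborSet v) :
    F (.inr y) = .inl (outer y) ∨ ∃ z, y ≠ z ∧ F (.inr y) = .inr z := by
  have h1 := (hF (.inr y)).1
  cases hy : F (.inr y) with
  | inl a =>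
    rw [hy] at h1
    exact Or.inl (congrArg Sum.inl (Subtype.ext h1))
  | inr z =>
    rw [hy] at h1
    exact Or.inr ⟨z, h1, rfl⟩

theorem apply_inl_cases (a : {w : V // w ≠ v}) :
    (∃ b : {w : V // w ≠ v}, G.Adj a b ∧ F (.inl a) = .inl b) ∨
      ∃ x, outer x = a ∧ F (.inl a) = .inr x := by
  have h1 := (hF (.inl a)).1
  cases hy : F (.inl a) with
  | inl b =>
    rw [hy] at h1
    exact Or.inl ⟨b, h1, rfl⟩
  | inr x =>
    rw [hy] at h1
    exact Or.inr ⟨x, Subtype.ext (Eq.symm h1), rfl⟩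

theorem apply_third {x y z : G.neighborSet v} (hyz : F (.inr y) = .inr z) (hxy : x ≠ y)
    (hxz : x ≠ z) (hall : ∀ u, u = x ∨ u = y ∨ u = z) : F (.inr x) = .inl (outer x) := by
  rcases apply_inr_cases hF x with h | ⟨u, hu, h⟩
  · exact h
  · have h' := hF.apply_eq_comm.1 h
    rcases hall u with rfl | rfl | rfl
    · exact absurd rfl hu
    · rw [hyz] at h'; exact absurd (Sum.inr_injective h').symm hxz
    · rw [hF.apply_eq_comm.1 hyz] at h'; exact absurd (Sum.inr_injective h').symm hxy

theorem apply_inr_of_third {x y z : G.neighborSet v} (hx : F (.inr x) = .inl (outer x))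
    (hy : F (.inr y) ≠ .inl (outer y)) (hall : ∀ u, u = x ∨ u = y ∨ u = z) :
    F (.inr y) = .inr z := by
  rcases apply_inr_cases hF y with h | ⟨u, hu, h⟩
  · exact absurd h hy
  · rcases hall u with rfl | rfl | rfl
    · rw [hF.apply_eq_comm.1 h] at hx
      exact absurd hx (by simp)
    · exact absurd rfl hu
    · exact h

end Match

/-- The matching `F` of `G^v` arises from the matching `f` of `G`. -/
def IsLift (G : SimpleGraph V) (v : V) (f : V → V)
    (F : ExpandVertex G v → ExpandVertex G v) : Prop :=
  (∀ a b : {w : V // w ≠ v}, F (.inl a) = .inl b ↔ f a = b) ∧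
    ∀ x : G.neighborSet v, F (.inr x) = .inl (outer x) ↔ f v = x

/-- The old neighbour of a vertex of `G^v`, with `v` for all new vertices. -/
def project : ExpandVertex G v → V := Sum.elim Subtype.val fun _ => v

theorem IsLift.unique_base {f f' : V → V} {F : ExpandVertex G v → ExpandVertex G v}
    (hf : IsPartnerFn G f) (hf' : IsPartnerFn G f') (h : IsLift G v f F) (h' : IsLift G v f' F) :
    f = f' := by
  have hv : f v = f' v := by
    have h1 := (h.2 ⟨f v, (hf v).1⟩).2 rfl
    exact ((h'.2 _).1 h1).symm
  funext w
  by_cases hw : w = v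
  · rw [hw, hv]
  by_cases hfw : f w = v
  · rw [hfw]
    have h1 := hf.apply_eq_comm.1 hfw
    rw [hv] at h1
    exact (hf'.apply_eq_comm.1 h1).symm
  · have h1 := (h.1 ⟨w, hw⟩ ⟨f w, hfw⟩).2 rfl
    exact ((h'.1 _ _).1 h1).symm

/-- The lift relation fixes `F` on old vertices and on the one matched spoke; the other two triangle
vertices can then only be matched to each other. -/
theorem IsLift.unique (hG : G.IsRegularOfDegree 3) {f : V → V}
    {F F' : ExpandVertex G v → ExpandVertex G v}
    (hf : IsPartnerFn G f) (hF : IsPartnerFn (expand G v) F) (hF' : IsPartnerFn (expand G v) F')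
    (h : IsLift G v f F) (h' : IsLift G v f F') : F = F' := by
  funext w
  rcases w with a | y
  · by_cases hfa : f a = v
    · have h1 := hf.apply_eq_comm.1 hfa
      have hadj : G.Adj v a := h1 ▸ (hf v).1
      have h2 := hF.apply_eq_comm.1 ((h.2 ⟨a, hadj⟩).2 h1)
      have h3 := hF'.apply_eq_comm.1 ((h'.2 ⟨a, hadj⟩).2 h1)
      exact h2.trans h3.symm
    · exact ((h.1 a ⟨f a, hfa⟩).2 rfl).trans ((h'.1 a ⟨f a, hfa⟩).2 rfl).symm
  · by_cases hy : f v = y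
    · exact ((h.2 y).2 hy).trans ((h'.2 y).2 hy).symm
    · have hne : (⟨f v, (hf v).1⟩ : G.neighborSet v) ≠ y := fun hh => hy (congrArg Subtype.val hh)
      obtain ⟨z, -, -, hall⟩ := exists_third hG hne
      have hall' : ∀ u, u = ⟨f v, (hf v).1⟩ ∨ u = y ∨ u = z := fun u => by
        have := hall u
        tauto
      rw [apply_inr_of_third hF ((h.2 ⟨f v, (hf v).1⟩).2 rfl) (fun hh => hy ((h.2 y).1 hh)) hall',
        apply_inr_of_third hF' ((h'.2 ⟨f v, (hf v).1⟩).2 rfl) (fun hh => hy ((h'.2 y).1 hh)) hall']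

theorem exists_isLift (hG : G.IsRegularOfDegree 3) {f : V → V} (hf : IsPartnerFn G f) :
    ∃ F, IsPartnerFn (expand G v) F ∧ IsLift G v f F := by
  classical
  let x : G.neighborSet v := ⟨f v, (hf v).1⟩
  obtain ⟨y, z, hxy, hxz, hyz, hall⟩ := exists_other_two hG x
  let F : ExpandVertex G v → ExpandVertex G v := Sum.elim
    (fun w => if h : f w ≠ v then .inl ⟨f w, h⟩ else .inr x)
    (fun u => if u = x then .inl (outer x) else if u = y then .inr z else .inr y)
  have Fx : F (.inr x) = .inl (outer x) := by simp [F]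
  have Fy : F (.inr y) = .inr z := by simp [F, hxy.symm]
  have Fz : F (.inr z) = .inr y := by simp [F, hxz.symm, hyz.symm]
  have Fa : ∀ a : {w : V // w ≠ v}, ∀ h : f a ≠ v, F (.inl a) = .inl ⟨f a, h⟩ := fun a h => by
    simp [F, h]
  have Fo : ∀ a : {w : V // w ≠ v}, f a = v → a = outer x := fun a h =>
    Subtype.ext (hf.apply_eq_comm.1 h).symm
  have Fo' : F (.inl (outer x)) = .inr x := by
    have : f (outer x).1 = v := (hf v).2
    simp [F, this]
  refine ⟨F, ?_, ?_, ?_⟩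
  · rintro (a | u)
    · by_cases h : f a = v
      · rw [Fo a h, Fo', Fx]
        exact ⟨rfl, rfl⟩
      · have h' : f (f a) ≠ v := by rw [(hf a).2]; exact a.2
        rw [Fa a h, Fa ⟨f a, h⟩ h']
        exact ⟨(hf a).1, congrArg Sum.inl (Subtype.ext (hf a).2)⟩
    · rcases hall u with rfl | rfl | rfl
      · rw [Fx, Fo']; exact ⟨rfl, rfl⟩
      · rw [Fy, Fz]; exact ⟨hyz, rfl⟩
      · rw [Fz, Fy]; exact ⟨hyz.symm, rfl⟩
  · intro a b
    by_cases h : f a = v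
    · rw [Fo a h, Fo', show f (outer x).1 = v from (hf v).2]
      exact ⟨fun hh => by simp at hh, fun hh => absurd hh.symm b.2⟩
    · rw [Fa a h]
      exact ⟨fun hh => congrArg Subtype.val (Sum.inl_injective hh),
        fun hh => congrArg Sum.inl (Subtype.ext hh)⟩
  · intro u
    rcases hall u with rfl | rfl | rfl
    · exact ⟨fun _ => rfl, fun _ => Fx⟩
    · rw [Fy]
      exact ⟨fun hh => by simp at hh, fun hh => absurd (Subtype.ext hh) hxy⟩
    · rw [Fz]
      exact ⟨fun hh => by simp at hh, fun hh => absurd (Subtype.ext hh) hxz⟩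

theorem exists_expand_of_isMatchFn {g : V → V}
    (hg : IsMatchFn G (insert v (G.neighborFinset v))ᶜ g) :
    ∃ F, IsPartnerFn (expand G v) F ∧ (∀ x, F (.inr x) = .inl (outer x)) ∧
      ∀ a b : {w : V // w ≠ v}, a.1 ∈ (insert v (G.neighborFinset v))ᶜ → g a = b →
        F (.inl a) = .inl b := by
  have hmem := mem_compl_insert_neighborFinset (G := G) (v := v)
  let F : ExpandVertex G v → ExpandVertex G v := Sum.elim
    -- The value `.inl w` is never used: outside the closed neighbourhood of `v`, `g` does not take
    -- the value `v`.
    (fun w => if h : G.Adj v w then .inr ⟨w, h⟩ else if h' : g w ≠ v then .inl ⟨g w, h'⟩ else .inl w)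
    (fun u => .inl (outer u))
  have Fx : ∀ x : G.neighborSet v, F (.inl (outer x)) = .inr x := fun x => by
    have : G.Adj v (outer x).1 := x.2
    simp only [F, Sum.elim_inl, this, dite_true]
    rfl
  have Fa : ∀ a b : {w : V // w ≠ v}, a.1 ∈ (insert v (G.neighborFinset v))ᶜ → g a = b →
        F (.inl a) = .inl b := by
    intro a b ha hab
    have h1 : ¬ G.Adj v a := ((hmem _).1 ha).2
    have h2 : g a ≠ v := hab ▸ b.2
    simp only [F, Sum.elim_inl, h1, dite_false, h2, ne_eq, not_false_eq_true, dite_true]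
    exact congrArg Sum.inl (Subtype.ext hab)
  refine ⟨F, ?_, fun x => rfl, Fa⟩
  rintro (a | u)
  · by_cases h : G.Adj v a
    · have : a = outer ⟨a.1, h⟩ := rfl
      rw [this, Fx]
      exact ⟨rfl, rfl⟩
    · have ha := (hmem a).2 ⟨a.2, h⟩
      obtain ⟨h1, h2, h3⟩ := hg a ha
      have h4 := ((hmem _).1 h1).1
      rw [Fa a ⟨g a, h4⟩ ha rfl, Fa ⟨g a, h4⟩ a h1 h3]
      exact ⟨h2, rfl⟩
  · exact ⟨rfl, Fx u⟩

/-- Perfect matchings of `G^v` come from perfect matchings or from `v`-joins of `G`. -/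
theorem isPartnerFn_expand_cases (hG : G.IsRegularOfDegree 3)
    {F : ExpandVertex G v → ExpandVertex G v} (hF : IsPartnerFn (expand G v) F) :
    ((∀ x, F (.inr x) = .inl (outer x)) ∧ ∃ g, IsMatchFn G (insert v (G.neighborFinset v))ᶜ g ∧
      ∀ a b : {w : V // w ≠ v}, F (.inl a) = .inl b →
        a.1 ∈ (insert v (G.neighborFinset v))ᶜ ∧ g a = b) ∨
    ∃ f, IsPartnerFn G f ∧ IsLift G v f F := by
  have hmem := mem_compl_insert_neighborFinset (G := G) (v := v)
  by_cases hall : ∀ x, F (.inr x) = .inl (outer x)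
  · refine Or.inl ⟨hall, fun w => if h : w ≠ v then project (F (.inl ⟨w, h⟩)) else v, ?_, ?_⟩
    all_goals
      have key : ∀ a b : {w : V // w ≠ v}, F (.inl a) = .inl b →
          a.1 ∈ (insert v (G.neighborFinset v))ᶜ := by
        intro a b hab
        refine (hmem _).2 ⟨a.2, fun hh => ?_⟩
        have := hF.apply_eq_comm.1 (hall ⟨a.1, hh⟩)
        have e : a = outer ⟨a.1, hh⟩ := rfl
        rw [← e, hab] at this
        simp at this
    · intro w hw
      have hw' := (hmem w).1 hw
      rcases apply_inl_cases hF ⟨w, hw'.1⟩ with ⟨b, hb, h1⟩ | ⟨x, hx, -⟩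
      · have h2 := hF.apply_eq_comm.1 h1
        have h3 := b.2
        simp only [ne_eq, hw'.1, not_false_eq_true, dite_true, h1, project, Sum.elim_inl, h3, h2]
        exact ⟨key _ _ h2, hb, trivial⟩
      · have : (x : V) = w := congrArg Subtype.val hx
        exact absurd (this ▸ x.2) hw'.2
    · intro a b hab
      refine ⟨key a b hab, ?_⟩
      simp [a.2, hab, project]
  · right
    push Not at hall
    obtain ⟨y, hy⟩ := hall
    obtain ⟨z, hyz, hFy⟩ := (apply_inr_cases hF y).resolve_left hy
    have hFz := hF.apply_eq_comm.1 hFy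
    obtain ⟨x, hxy, hxz, hall⟩ := exists_third hG hyz
    have hFx := apply_third hF hFy hxy hxz hall
    have hFox := hF.apply_eq_comm.1 hFx
    have hx : ∀ u, F (.inr u) = .inl (outer u) ↔ u = x := by
      intro u
      rcases hall u with rfl | rfl | rfl
      · exact ⟨fun _ => rfl, fun _ => hFx⟩
      · rw [hFy]; exact ⟨fun hh => by simp at hh, fun hh => absurd hh.symm hxy⟩
      · rw [hFz]; exact ⟨fun hh => by simp at hh, fun hh => absurd hh.symm hxz⟩
    -- Contracting the triangle: `x` is the only triangle vertex matched outside, so it supplies the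
    -- partner of `v`.
    let f : V → V := fun w => if h : w ≠ v then project (F (.inl ⟨w, h⟩)) else x
    have fv : f v = x := by simp [f]
    have fa : ∀ a : {w : V // w ≠ v}, f a = project (F (.inl a)) := fun a => by simp [f, a.2]
    have fx : f x = v := by
      have := fa (outer x)
      rw [hFox] at this
      exact this
    refine ⟨f, fun w => ?_, fun a b => ?_, fun u => ?_⟩
    · by_cases hw : w = v
      · subst hw
        rw [fv, fx]; exact ⟨x.2, rfl⟩
      · have h0 := fa ⟨w, hw⟩
        rcases apply_inl_cases hF ⟨w, hw⟩ with ⟨b, hb, h1⟩ | ⟨u, hu, h1⟩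
        · have h2 := fa b
          rw [hF.apply_eq_comm.1 h1] at h2
          rw [h1] at h0
          have h0' : f w = b := h0
          rw [h0']
          exact ⟨hb, h2⟩
        · rw [← hu] at h1
          have hux := (hx u).1 (hF.apply_eq_comm.1 h1)
          have hwx : w = x := by rw [← hux]; exact (congrArg Subtype.val hu).symm
          rw [hwx, fx, fv]
          exact ⟨(show G.Adj v x from x.2).symm, rfl⟩
    · rw [fa]
      rcases apply_inl_cases hF a with ⟨c, hc, h1⟩ | ⟨u, hu, h1⟩
      · rw [h1]
        exact ⟨fun hh => congrArg Subtype.val (Sum.inl_injective hh),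
          fun hh => congrArg Sum.inl (Subtype.ext hh)⟩
      · rw [h1]
        exact ⟨fun hh => by simp at hh, fun hh => absurd (Eq.symm hh) b.2⟩
    · rw [hx, fv]
      exact ⟨fun hh => by rw [hh], fun hh => Subtype.ext hh.symm⟩

end Expand

/-! ### Lonely edges of `G^v` by type, and the count -/

section Count
variable {V : Type*} [Fintype V] [DecidableEq V] {G : SimpleGraph V} [DecidableRel G.Adj] {v : V}

theorem IsThreeConnected.connected (hc : IsThreeConnected G) : G.Connected := by
  have := hc.2 ∅ (by simp)
  rw [Finset.coe_empty, Set.compl_empty] at this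
  exact (SimpleGraph.induceUnivIso G).connected_iff.1 this

theorem exists_isPartnerFn (h : G.IsRegularOfDegree 3) (hG : OddCutsLarge G) {a b : V}
    (hab : G.Adj a b) : ∃ f, IsPartnerFn G f ∧ f a = b := by
  obtain ⟨f, hf, hfab⟩ := exists_isMatchFn_univ h hG hab
  exact ⟨f, isMatchFn_univ_iff.1 hf, hfab⟩

theorem isLonely_expand_old_iff (h : G.IsRegularOfDegree 3) (hG : OddCutsLarge G)
    (a b : {w : V // w ≠ v}) :
    IsLonely (expand G v) s(.inl a, .inl b) ↔
      IsLonely G s(a.1, b.1) ∧ ¬ ∃ J : G.Subgraph, IsJoin G v J ∧ s(a.1, b.1) ∈ J.edgeSet := by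
  rw [exists_isJoin_iff h a.2 b.2, isLonely_mk_iff, isLonely_mk_iff]
  constructor
  · rintro ⟨F, ⟨hF, hFab⟩, huniq⟩
    have hab : G.Adj a b := by
      have := (hF (.inl a)).1
      rw [hFab] at this
      exact this
    obtain ⟨f, hf, hfab⟩ := exists_isPartnerFn h hG hab
    have hlift : ∀ f, IsPartnerFn G f → f a = b → IsLift G v f F := by
      intro f hf hfab
      obtain ⟨F', hF', hl⟩ := exists_isLift h hf (v := v)
      rw [← huniq F' ⟨hF', (hl.1 a b).2 hfab⟩]
      exact hl
    refine ⟨⟨f, ⟨hf, hfab⟩, fun f' hf' =>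
      (hlift f' hf'.1 hf'.2).unique_base hf'.1 hf (hlift f hf hfab)⟩, ?_⟩
    rintro ⟨g, hg, ha, hgab⟩
    obtain ⟨F', hF', hx, hgF⟩ := exists_expand_of_isMatchFn hg
    have hl := hlift f hf hfab
    rw [← huniq F' ⟨hF', hgF a b ha hgab⟩] at hl
    -- A matching coming from a `v`-join uses every spoke, a lift only one, so they cannot coincide.
    obtain ⟨y, z, hxy, -, -, -⟩ := exists_other_two h ⟨f v, (hf v).1⟩
    exact hxy (Subtype.ext ((hl.2 y).1 (hx y)))
  · rintro ⟨⟨f, ⟨hf, hfab⟩, huniq⟩, hno⟩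
    obtain ⟨F, hF, hl⟩ := exists_isLift h hf (v := v)
    refine ⟨F, ⟨hF, (hl.1 a b).2 hfab⟩, fun F' ⟨hF', hab'⟩ => ?_⟩
    rcases isPartnerFn_expand_cases h hF' with ⟨-, g, hg, hgF⟩ | ⟨f', hf', hl'⟩
    · exact absurd ⟨g, hg, hgF a b hab'⟩ hno
    · have := huniq f' ⟨hf', (hl'.1 a b).1 hab'⟩
      subst this
      exact hl'.unique h hf' hF' hF hl

theorem isLonely_expand_triangle_iff (h : G.IsRegularOfDegree 3) {x y z : G.neighborSet v}
    (hxy : x ≠ y) (hxz : x ≠ z) (hall : ∀ u, u = x ∨ u = y ∨ u = z) :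
    IsLonely (expand G v) s(.inr y, .inr z) ↔ IsLonely G s(v, x.1) := by
  rw [isLonely_mk_iff, isLonely_mk_iff]
  have key : ∀ {f F}, IsPartnerFn (expand G v) F → IsLift G v f F →
      (F (.inr y) = .inr z ↔ f v = x) := by
    intro f F hF hl
    rw [← hl.2]
    refine ⟨fun hh => apply_third hF hh hxy hxz hall, fun hh => ?_⟩
    refine apply_inr_of_third hF hh (fun hy => hxy (Subtype.ext ?_)) hall
    rw [← (hl.2 x).1 hh, (hl.2 y).1 hy]
  constructor
  · rintro ⟨F, ⟨hF, hFyz⟩, huniq⟩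
    rcases isPartnerFn_expand_cases h hF with ⟨hx, -⟩ | ⟨f, hf, hl⟩
    · rw [hx] at hFyz; simp at hFyz
    · refine ⟨f, ⟨hf, (key hF hl).1 hFyz⟩, fun f' ⟨hf', hfx⟩ => ?_⟩
      obtain ⟨F', hF', hl'⟩ := exists_isLift h hf' (v := v)
      rw [huniq F' ⟨hF', (key hF' hl').2 hfx⟩] at hl'
      exact hl'.unique_base hf' hf hl
  · rintro ⟨f, ⟨hf, hfx⟩, huniq⟩
    obtain ⟨F, hF, hl⟩ := exists_isLift h hf (v := v)
    refine ⟨F, ⟨hF, (key hF hl).2 hfx⟩, fun F' ⟨hF', hyz'⟩ => ?_⟩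
    rcases isPartnerFn_expand_cases h hF' with ⟨hx, -⟩ | ⟨f', hf', hl'⟩
    · rw [hx] at hyz'; simp at hyz'
    · have := huniq f' ⟨hf', (key hF' hl').1 hyz'⟩
      subst this
      exact hl'.unique h hf' hF' hF hl

/-- With a `v`-join, the spoke lies both in the matching it induces and in a lift; without one, two
perfect matchings of `G` through `vx` have distinct lifts. -/
theorem not_isLonely_expand_spoke (h : G.IsRegularOfDegree 3) (hG : OddCutsLarge G)
    (hconn : G.Connected) (x : G.neighborSet v) :
    ¬ IsLonely (expand G v) s(.inr x, .inl (outer x)) := by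
  rw [isLonely_mk_iff]
  rintro ⟨F, -, huniq⟩
  have hlift : ∀ f, IsPartnerFn G f → f v = x → IsLift G v f F := by
    intro f hf hfx
    obtain ⟨F', hF', hl⟩ := exists_isLift h hf (v := v)
    rw [← huniq F' ⟨hF', (hl.2 x).2 hfx⟩]
    exact hl
  by_cases hno : ∃ g, IsMatchFn G (insert v (G.neighborFinset v))ᶜ g
  · obtain ⟨g, hg⟩ := hno
    obtain ⟨F', hF', hx, -⟩ := exists_expand_of_isMatchFn hg
    obtain ⟨f, hf, hfx⟩ := exists_isPartnerFn h hG x.2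
    have hl := hlift f hf hfx
    rw [← huniq F' ⟨hF', hx x⟩] at hl
    obtain ⟨y, z, hxy, -, -, -⟩ := exists_other_two h x
    exact hxy (Subtype.ext (hfx.symm.trans ((hl.2 y).1 (hx y))))
  · obtain ⟨f₁, f₂, hf₁, hf₂, h₁, h₂, hne⟩ := exists_two_isMatchFn h hG hconn x.2 hno
    rw [isMatchFn_univ_iff] at hf₁ hf₂
    exact hne ((hlift f₁ hf₁ h₁).unique_base hf₁ hf₂ (hlift f₂ hf₂ h₂))

theorem lonelyCount_expand (h : G.IsRegularOfDegree 3) (hG : OddCutsLarge G)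
    (hconn : G.Connected) (v : V) :
    lonelyCount (expand G v) + joinLonelyCount G v = lonelyCount G := by
  classical
  choose y z hxy hxz hyz hall using exists_other_two h (v := v)
  set J := {e : Sym2 V | IsLonely G e ∧ v ∉ e ∧ ∃ J : G.Subgraph, IsJoin G v J ∧ e ∈ J.edgeSet}
    with hJ
  let A : Set (Sym2 {w : V // w ≠ v}) := {e | IsLonely G (e.map Subtype.val) ∧
    ¬ ∃ J : G.Subgraph, IsJoin G v J ∧ e.map Subtype.val ∈ J.edgeSet}
  let X : Set (G.neighborSet v) := {x | IsLonely G s(v, x.1)}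
  have hval : ∀ e : Sym2 {w : V // w ≠ v}, v ∉ e.map Subtype.val := by
    intro e he
    obtain ⟨w, -, hw⟩ := Sym2.mem_map.1 he
    exact w.2 hw
  -- `A` holds the edges avoiding `v` that stay lonely, `X` the lonely edges at `v`. In `G^v` the
  -- edge at `v` indexed by `x` is replaced by the triangle edge opposite `v_x`, so both sides are
  -- counted by `|A| + |X|`.
  have h1 : {e | IsLonely G e} \ J = Sym2.map Subtype.val '' A ∪ (fun x => s(v, x.1)) '' X := by
    ext e
    constructor
    · rintro ⟨he, heJ⟩
      by_cases hv : v ∈ e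
      · obtain ⟨x, rfl⟩ := hv
        have hx : G.Adj v x := he.1
        exact Or.inr ⟨⟨x, hx⟩, he, rfl⟩
      · induction e using Sym2.ind with
        | _ a b =>
        simp only [Sym2.mem_iff, not_or] at hv
        refine Or.inl ⟨s(⟨a, Ne.symm hv.1⟩, ⟨b, Ne.symm hv.2⟩), ⟨he, fun hj => heJ ⟨he, ?_, hj⟩⟩, rfl⟩
        simpa [not_or] using hv
    · rintro (⟨e, ⟨he, hno⟩, rfl⟩ | ⟨x, hx, rfl⟩)
      · exact ⟨he, fun hj => hno hj.2.2⟩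
      · exact ⟨hx, fun hj => hj.2.1 (Sym2.mem_mk_left _ _)⟩
  have h2 : {e | IsLonely (expand G v) e} =
      Sym2.map Sum.inl '' A ∪ (fun x => s(.inr (y x), .inr (z x))) '' X := by
    ext e
    constructor
    · induction e using Sym2.ind with
      | _ p q =>
      intro he
      have hadj : (expand G v).Adj p q := he.1
      rcases p with a | s <;> rcases q with b | t
      · exact Or.inl ⟨s(a, b), (isLonely_expand_old_iff h hG a b).1 he, rfl⟩
      · have : a = outer t := Subtype.ext hadj
        subst this
        rw [Sym2.eq_swap] at he
        exact absurd he (not_isLonely_expand_spoke h hG hconn t)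
      · have : b = outer s := Subtype.ext hadj
        subst this
        exact absurd he (not_isLonely_expand_spoke h hG hconn s)
      · have hst : s ≠ t := hadj
        obtain ⟨x, hxs, hxt, hall'⟩ := exists_third h hst
        refine Or.inr ⟨x, (isLonely_expand_triangle_iff h hxs hxt hall').1 he, ?_⟩
        rcases hall' (y x) with hy | hy | hy <;> rcases hall' (z x) with hz | hz | hz <;>
          first
          | exact absurd hy.symm (hxy x)
          | exact absurd hz.symm (hxz x)
          | exact absurd (hy.trans hz.symm) (hyz x)
          | (simp only [hy, hz]; try exact Sym2.eq_swap)
    · rintro (⟨e, he, rfl⟩ | ⟨x, hx, rfl⟩)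
      · induction e using Sym2.ind with
        | _ a b => exact (isLonely_expand_old_iff h hG a b).2 he
      · exact (isLonely_expand_triangle_iff h (hxy x) (hxz x) (hall x)).2 hx
  have i1 : Function.Injective (fun x : G.neighborSet v => s(v, x.1)) := fun s t hst =>
    Subtype.ext (Sym2.congr_right.1 hst)
  have i2 : Function.Injective (fun x : G.neighborSet v =>
      (s(.inr (y x), .inr (z x)) : Sym2 (ExpandVertex G v))) := by
    intro s t hst
    by_contra hne
    have h3 : ∀ u, u = y s ∨ u = z s ↔ u = y t ∨ u = z t := by
      intro u
      have := Sym2.ext_iff.1 hst (.inr u)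
      simpa [Sym2.mem_iff] using this
    -- If the triangle edges opposite `s ≠ t` agreed, `t` would be an end of the edge opposite
    -- itself.
    have h4 : t = y s ∨ t = z s := by
      have := hall s t
      tauto
    rcases (h3 t).1 h4 with h5 | h5
    · exact hxy t h5
    · exact hxz t h5
  have d1 : Disjoint (Sym2.map Subtype.val '' A) ((fun x : G.neighborSet v => s(v, x.1)) '' X) := by
    rw [Set.disjoint_left]
    rintro _ ⟨e, -, rfl⟩ ⟨x, -, hx⟩
    exact hval e (hx ▸ Sym2.mem_mk_left _ _)
  have d2 : Disjoint (Sym2.map Sum.inl '' A)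
      ((fun x : G.neighborSet v =>
        (s(.inr (y x), .inr (z x)) : Sym2 (ExpandVertex G v))) '' X) := by
    rw [Set.disjoint_left]
    rintro _ ⟨e, -, rfl⟩ ⟨x, -, hx⟩
    have : (.inr (y x) : ExpandVertex G v) ∈ Sym2.map Sum.inl e := hx ▸ Sym2.mem_mk_left _ _
    obtain ⟨w, -, hw⟩ := Sym2.mem_map.1 this
    exact Sum.inl_ne_inr hw
  have hsub : J ⊆ {e | IsLonely G e} := fun e he => he.1
  have h3 := Set.ncard_sdiff_add_ncard_of_subset hsub
  rw [h1, Set.ncard_union_eq d1, Set.ncard_image_of_injective _ i1,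
    Set.ncard_image_of_injective _ (Sym2.map.injective Subtype.val_injective)] at h3
  have h4 : lonelyCount (expand G v) = A.ncard + X.ncard := by
    rw [lonelyCount, h2, Set.ncard_union_eq d2, Set.ncard_image_of_injective _ i2,
      Set.ncard_image_of_injective _ (Sym2.map.injective Sum.inl_injective)]
  rw [h4]
  exact h3

end Count
end LonelyEdges

theorem mainTheorem5 {V : Type*} [Fintype V] (G : SimpleGraph V) [DecidableRel G.Adj]
    (hG : LonelyEdges.ClassU G) (v : V) :
    (LonelyEdges.lonelyCount (LonelyEdges.expand G v) : ℤ) =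
      (LonelyEdges.lonelyCount G : ℤ) - (LonelyEdges.joinLonelyCount G v : ℤ) := by
  classical
  have := LonelyEdges.lonelyCount_expand hG.cubic
    (LonelyEdges.oddCutsLarge hG.cubic hG.threeConnected) hG.threeConnected.connected v
  omega
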